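/- A variety $\mathcal V$ (the class of all algebras of a fixed signature that satisfy a given set of identities) is called \emph{Taylor} if for some $n\ge 1$ it has an $n$-ary term $f$ that is idempotent, i.e. $f(x,\dots,x)\approx x$, and that satisfies for each $i\in\{1,\dots,n\}$ an equation $f(x_{i1},\dots,x_{in})\approx f(y_{i1},\dots,y_{in})$ with all $x_{ij},y_{ij}\in\{x,y\}$ and $x_{ii}\neq y_{ii}$. **Theorem.** Let $\mathcal V$ be a variety. Then the following are equivalent: 1. $\mathcal V$ is Taylor; 2. there is a $6$-ary term $t$, idempotent in $\mathcal V$, such that $\mathcal V$ satisfies the term equations $$t(x,y,y,y,x,x)\approx t(y,x,y,x,y,x)\approx t(y,y,x,x,x,y);$$ 3. for every algebra $\mathbf A\in\mathcal V$ and all congruences $\alpha_1,\dots,\alpha_6,\beta_1,\dots,\beta_6$ of $\mathbf A$, $$\bigcap_{i=1}^{6}(\alpha_i\circ\beta_i)\ \subseteq\ \Bigl(\bigl(\bigvee_{i=1}^{6}\alpha_i\bigr)\wedge\bigwedge_{k=1}^{2}(\gamma\vee\theta_k)\Bigr)\vee\Bigl(\bigl(\bigvee_{i=1}^{6}\beta_i\bigr)\wedge\bigwedge_{k=1}^{2}(\gamma\vee\theta_k)\Bigr),$$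 where $\circ$ is the relational product, $\vee$ and $\wedge$ are join and meet in the congruence lattice of $\mathbf A$, $\gamma=\bigwedge_{i=1}^{6}(\alpha_i\vee\beta_i)$, and for $k=1,2$ $$\theta_k=\Bigl(\bigvee_{j\in L_k}\alpha_j\vee\bigvee_{j\in L'_k}\beta_j\Bigr)\wedge\Bigl(\bigvee_{j\in R_k}\alpha_j\vee\bigvee_{j\in R'_k}\beta_j\Bigr)$$ with $L_1=L_2=\{1,5,6\}$, $L'_1=L'_2=\{2,3,4\}$, $R_1=\{2,4,6\}$, $R'_1=\{1,3,5\}$, $R_2=\{3,4,5\}$, $R'_2=\{1,2,6\}$. -/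

import Mathlib

universe u v w

namespace UniversalAlgebra

/-! ## Congruences of an algebra and their complete lattice

An algebra of signature `L` is an `L.Structure`, where `L` is a first-order language without
relation symbols (`L.IsAlgebraic`). -/

/-- A congruence of the algebra `A`: an equivalence relation compatible with all basic
operations. -/
@[ext]
structure Congruence (L : FirstOrder.Language.{u, v}) (A : Type w) [L.Structure A] extends Setoid A where
  map_funMap : ∀ {n : ℕ} (f : L.Functions n) (x y : Fin n → A),
    (∀ i, r (x i) (y i)) → r (FirstOrder.Language.Structure.funMap f x) (FirstOrder.Language.Structure.funMap f y)

namespace Congruence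

variable {L : FirstOrder.Language.{u, v}} {A : Type w} [L.Structure A]

/-- The binary relation underlying a congruence. -/
def Rel (θ : Congruence L A) (a b : A) : Prop := θ.toSetoid a b

theorem rel_refl (θ : Congruence L A) (a : A) : θ.Rel a a := θ.toSetoid.refl' a

theorem rel_symm (θ : Congruence L A) {a b : A} (h : θ.Rel a b) : θ.Rel b a :=
  θ.toSetoid.symm' h

theorem rel_trans (θ : Congruence L A) {a b c : A} (h : θ.Rel a b) (h' : θ.Rel b c) :
    θ.Rel a c :=
  θ.toSetoid.trans' h h'

/-- Congruences are ordered by inclusion. -/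
instance : PartialOrder (Congruence L A) where
  le θ φ := ∀ a b, θ.Rel a b → φ.Rel a b
  le_refl _ _ _ h := h
  le_trans _ _ _ h h' a b hab := h' a b (h a b hab)
  le_antisymm θ φ h h' := by
    apply Congruence.ext
    funext a b
    exact propext ⟨h a b, h' a b⟩

/-- The meet of a set of congruences is their intersection. -/
instance : InfSet (Congruence L A) where
  sInf S :=
    { r := fun a b => ∀ θ ∈ S, θ.Rel a b
      iseqv :=
        { refl := fun a θ _ => θ.rel_refl a
          symm := fun h θ hθ => θ.rel_symm (h θ hθ)
          trans := fun h h' θ hθ => θ.rel_trans (h θ hθ) (h' θ hθ) }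
      map_funMap := fun f x y h θ hθ => θ.map_funMap f x y fun i => h i θ hθ }

/-- The congruence lattice `Con(A)`: joins are least upper bounds among congruences. -/
instance : CompleteLattice (Congruence L A) :=
  completeLatticeOfInf _ fun _ =>
    ⟨fun _ hθ _ _ h => h _ hθ, fun _ hφ a b hab θ hθ => hφ hθ a b hab⟩

end Congruence

/-! ## Varieties and term equations -/

/-- A variety of signature `L`, presented by a set of identities (pairs of terms) in countably
many variables. -/
structure Variety (L : FirstOrder.Language.{u, v}) where
  identities : Set (L.Term ℕ × L.Term ℕ)

namespace Variety

variable {L : FirstOrder.Language.{u, v}}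

/-- The algebra `A` belongs to the variety `V`: it satisfies all defining identities. -/
def Mem (V : Variety L) (A : Type w) [L.Structure A] : Prop :=
  ∀ e ∈ V.identities, ∀ x : ℕ → A, e.1.realize x = e.2.realize x

/-- The variety `V` satisfies the term equation `p ≈ q`. -/
def Satisfies (V : Variety L) {X : Type} (p q : L.Term X) : Prop :=
  ∀ (A : Type (max u w)) [L.Structure A], V.Mem A → ∀ x : X → A, p.realize x = q.realize x

/-- The `n`-ary term `t` is idempotent in `V`: `t(x, …, x) ≈ x`. -/
def IsIdempotent (V : Variety L) {n : ℕ} (t : L.Term (Fin n)) : Prop :=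
  Satisfies.{u, v, w} V (t.relabel fun _ => (0 : Fin 1)) (FirstOrder.Language.Term.var 0)

/-- `t` is an `n`-ary Taylor term of `V`: it is idempotent, and for each `i` it satisfies an
equation `t(x_{i1}, …, x_{in}) ≈ t(y_{i1}, …, y_{in})` in two variables (here `0` and `1`)
with `x_{ii} ≠ y_{ii}`. -/
def IsTaylorTerm (V : Variety L) {n : ℕ} (t : L.Term (Fin n)) : Prop :=
  IsIdempotent.{u, v, w} V t ∧
    ∃ x y : Fin n → Fin n → Fin 2, (∀ i, x i i ≠ y i i) ∧
      ∀ i, Satisfies.{u, v, w} V (t.relabel (x i)) (t.relabel (y i))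

/-- `V` is a Taylor variety: it has a Taylor term of some positive arity. -/
def IsTaylor (V : Variety L) : Prop :=
  ∃ n : ℕ, 1 ≤ n ∧ ∃ t : L.Term (Fin n), IsTaylorTerm.{u, v, w} V t

/-- `V` has an idempotent `6`-ary term `t` with
`t(x,y,y,y,x,x) ≈ t(y,x,y,x,y,x) ≈ t(y,y,x,x,x,y)` (`0` stands for `x`, `1` for `y`). -/
def HasOlsakTerm (V : Variety L) : Prop :=
  ∃ t : L.Term (Fin 6), IsIdempotent.{u, v, w} V t ∧
    Satisfies.{u, v, w} V (t.relabel (![0, 1, 1, 1, 0, 0] : Fin 6 → Fin 2))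
      (t.relabel (![1, 0, 1, 0, 1, 0] : Fin 6 → Fin 2)) ∧
    Satisfies.{u, v, w} V (t.relabel (![1, 0, 1, 0, 1, 0] : Fin 6 → Fin 2))
      (t.relabel (![1, 1, 0, 0, 0, 1] : Fin 6 → Fin 2))

end Variety

/-! ## The congruence inclusion

The indices `1, …, 6` are represented by `0, …, 5 : Fin 6`. -/

section CongruenceInclusion

variable {L : FirstOrder.Language.{u, v}} {A : Type w} [L.Structure A]

/-- `γ = ⋀ᵢ (αᵢ ∨ βᵢ)`. -/
def gamma (α β : Fin 6 → Congruence L A) : Congruence L A := ⨅ i, α i ⊔ β i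

/-- `(⋁_{j ∈ S} αⱼ) ∨ (⋁_{j ∈ S'} βⱼ)`. -/
def partialJoin (α β : Fin 6 → Congruence L A) (S S' : Finset (Fin 6)) : Congruence L A :=
  (⨆ j ∈ S, α j) ⊔ (⨆ j ∈ S', β j)

/-- `θ₁`, with `L₁ = {1,5,6}`, `L₁' = {2,3,4}`, `R₁ = {2,4,6}`, `R₁' = {1,3,5}`. -/
def theta₁ (α β : Fin 6 → Congruence L A) : Congruence L A :=
  partialJoin α β {0, 4, 5} {1, 2, 3} ⊓ partialJoin α β {1, 3, 5} {0, 2, 4}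

/-- `θ₂`, with `L₂ = {1,5,6}`, `L₂' = {2,3,4}`, `R₂ = {3,4,5}`, `R₂' = {1,2,6}`. -/
def theta₂ (α β : Fin 6 → Congruence L A) : Congruence L A :=
  partialJoin α β {0, 4, 5} {1, 2, 3} ⊓ partialJoin α β {2, 3, 4} {0, 1, 5}

/-- `((⋁ᵢ αᵢ) ∧ ⋀ₖ (γ ∨ θₖ)) ∨ ((⋁ᵢ βᵢ) ∧ ⋀ₖ (γ ∨ θₖ))`. -/
def taylorRhs (α β : Fin 6 → Congruence L A) : Congruence L A :=
  ((⨆ i, α i) ⊓ ((gamma α β ⊔ theta₁ α β) ⊓ (gamma α β ⊔ theta₂ α β))) ⊔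
    ((⨆ i, β i) ⊓ ((gamma α β ⊔ theta₁ α β) ⊓ (gamma α β ⊔ theta₂ α β)))

end CongruenceInclusion

/-- `V` satisfies the congruence inclusion: for every algebra `A` in `V` and all congruences
`α₁, …, α₆, β₁, …, β₆` of `A`, the intersection of the relational products `αᵢ ∘ βᵢ` is
contained in `taylorRhs α β`. -/
def Variety.SatisfiesTaylorInclusion {L : FirstOrder.Language.{u, v}} (V : Variety L) : Prop :=
  ∀ (A : Type (max u w)) [L.Structure A], V.Mem A → ∀ α β : Fin 6 → Congruence L A,
    ∀ a b : A, (∀ i, Relation.Comp (α i).Rel (β i).Rel a b) → (taylorRhs α β).Rel a b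

end UniversalAlgebra

/-! The implications are proved in the cycle 1 → 2 → 3 → 1.

1 → 2: On the free algebra on two generators, let R be the ternary relation generated under
idempotent terms by the nonconstant triples of generators (`OlsakRel`). A constant triple in R
yields the six-ary term. Take pairs as vertices and put an edge (a,b) → (b,c) when R(a,b,c); then a
loop is a constant triple. The loop comes from `exists_loop`: vertices are attached to biinfinite
words by a finite-window rule, and the Taylor operation is iterated over all words. By idempotence a
labelling and its shift evaluate to the same vertex, while the rule makes the two values adjacent.

2 → 3: If a αᵢ cᵢ βᵢ b for all i, then t(c) links a to b inside the right-hand side.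

3 → 1: Without a Taylor term, star composition and compactness choose a variable for every
idempotent term, compatibly with minors (`exists_isMinorChoice`). Through this choice, congruences
of the free algebra on eight generators are bounded by partitions of the generators (`IsBounded`),
and there the inclusion fails. -/

namespace UniversalAlgebra

/-! ## Sequences, shifts and local functions -/

section Local

variable {S : Type*}

/-- The sequence `w` read from position `d`. -/
def shift (d : ℤ) (w : ℤ → S) : ℤ → S := fun z => w (z + d)

@[simp] theorem shift_apply (d z : ℤ) (w : ℤ → S) : shift d w z = w (z + d) := rfl

@[simp] theorem shift_shift (d e : ℤ) (w : ℤ → S) : shift d (shift e w) = shift (d + e) w := by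
  funext z
  simp [add_assoc]

@[simp] theorem shift_zero (w : ℤ → S) : shift 0 w = w := by
  funext z
  simp

/-- The function `f` of biinfinite sequences depends on a finite window only. -/
def IsLocal {β : Type*} (f : (ℤ → S) → β) : Prop :=
  ∃ k : ℕ, ∀ w w' : ℤ → S, (∀ z : ℤ, |z| ≤ k → w z = w' z) → f w = f w'

namespace IsLocal

variable {β γ δ : Type*}

theorem const (b : β) : IsLocal fun _ : ℤ → S => b := ⟨0, fun _ _ _ => rfl⟩

theorem eval (z : ℤ) : IsLocal fun w : ℤ → S => w z :=
  ⟨z.natAbs, fun _ _ h => h z (by simp)⟩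

theorem comp {f : (ℤ → S) → β} (hf : IsLocal f) (g : β → γ) : IsLocal fun w => g (f w) := by
  obtain ⟨k, hk⟩ := hf
  exact ⟨k, fun w w' h => congrArg g (hk w w' h)⟩

theorem comp₂ {f : (ℤ → S) → β} {g : (ℤ → S) → γ} (hf : IsLocal f) (hg : IsLocal g)
    (h : β → γ → δ) : IsLocal fun w => h (f w) (g w) := by
  obtain ⟨k, hk⟩ := hf
  obtain ⟨l, hl⟩ := hg
  refine ⟨max k l, fun w w' H => ?_⟩
  change h (f w) (g w) = h (f w') (g w')
  rw [hk w w' fun z hz => H z (hz.trans (by simp)), hl w w' fun z hz => H z (hz.trans (by simp))]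

theorem shift {f : (ℤ → S) → β} (hf : IsLocal f) (d : ℤ) :
    IsLocal fun w => f (shift d w) := by
  obtain ⟨k, hk⟩ := hf
  refine ⟨k + d.natAbs, fun w w' H => hk _ _ fun z hz => H _ ?_⟩
  have := abs_add_le z d
  push_cast
  omega

theorem and {P Q : (ℤ → S) → Prop} (hP : IsLocal P) (hQ : IsLocal Q) :
    IsLocal fun w => P w ∧ Q w := hP.comp₂ hQ And

theorem or {P Q : (ℤ → S) → Prop} (hP : IsLocal P) (hQ : IsLocal Q) :
    IsLocal fun w => P w ∨ Q w := hP.comp₂ hQ Or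

theorem not {P : (ℤ → S) → Prop} (hP : IsLocal P) : IsLocal fun w => ¬P w := hP.comp Not

theorem forall_lt {P : ℕ → (ℤ → S) → Prop} (hP : ∀ i, IsLocal (P i)) (N : ℕ) :
    IsLocal fun w => ∀ i < N, P i w := by
  induction N with
  | zero => simpa using const True
  | succ N ih =>
    have : (fun w => ∀ i < N + 1, P i w) = fun w => (∀ i < N, P i w) ∧ P N w := by
      funext w
      exact propext Nat.forall_lt_succ_right
    rw [this]
    exact ih.and (hP N)

theorem exists_lt {P : ℕ → (ℤ → S) → Prop} (hP : ∀ i, IsLocal (P i)) (N : ℕ) :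
    IsLocal fun w => ∃ i < N, P i w := by
  have : (fun w => ∃ i < N, P i w) = fun w => ¬∀ i < N, ¬P i w := by
    funext w
    push Not
    rfl
  rw [this]
  exact (forall_lt (fun i => (hP i).not) N).not

open Classical in
theorem ite {P : (ℤ → S) → Prop} (hP : IsLocal P) {f g : (ℤ → S) → β} (hf : IsLocal f)
    (hg : IsLocal g) : IsLocal fun w => if P w then f w else g w := by
  have := hP.comp₂ (hf.comp₂ hg Prod.mk) fun p q => if p then q.1 else q.2
  exact this

theorem fin_pi {r : ℕ} {f : Fin r → (ℤ → S) → β} (hf : ∀ i, IsLocal (f i)) :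
    IsLocal fun w i => f i w := by
  choose k hk using hf
  refine ⟨Finset.univ.sup k, fun w w' H => funext fun i => hk i w w' fun z hz => H z ?_⟩
  exact hz.trans (by exact_mod_cast Finset.le_sup (Finset.mem_univ i))

end IsLocal

/-- A local maximal independent set of positions: given a local set `Z` of forced positions, no two
adjacent, and a local set `F` of forbidden positions, there is a local independent set containing
`Z`, avoiding `F`, and dominating all permitted positions, provided that adjacent permitted
positions have distinct colours. -/
theorem exists_local_maximal_independent {C : Type*} [Fintype C] {Z F : (ℤ → S) → Prop}
    {κ : (ℤ → S) → C} (hZ : IsLocal Z) (hF : IsLocal F) (hκ : IsLocal κ)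
    (hZF : ∀ w, Z w → ¬F w) (hZZ : ∀ w, Z w → ¬Z (shift 1 w))
    (hcol : ∀ w, ¬F w → ¬F (shift 1 w) → κ w ≠ κ (shift 1 w)) :
    ∃ M : (ℤ → S) → Prop, IsLocal M ∧ (∀ w, Z w → M w) ∧ (∀ w, M w → ¬F w) ∧
      (∀ w, M w → ¬M (shift 1 w)) ∧
      ∀ w, ¬F w → ¬M w → M (shift 1 w) ∨ M (shift (-1) w) := by
  classical
  -- Greedy choice, one colour at a time: permitted positions of the same colour are never adjacent,
  -- so all that are still undominated can be added at once by a local rule.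
  suffices H : ∀ s : Finset C, ∃ M : (ℤ → S) → Prop, IsLocal M ∧ (∀ w, Z w → M w) ∧
      (∀ w, M w → ¬F w) ∧ (∀ w, M w → ¬M (shift 1 w)) ∧
      ∀ w, ¬F w → κ w ∈ s → ¬M w → M (shift 1 w) ∨ M (shift (-1) w) by
    obtain ⟨M, h1, h2, h3, h4, h5⟩ := H Finset.univ
    exact ⟨M, h1, h2, h3, h4, fun w hw => h5 w hw (Finset.mem_univ _)⟩
  intro s
  induction s using Finset.induction_on with
  | empty => exact ⟨Z, hZ, fun _ h => h, hZF, hZZ, fun w _ h => by simp at h⟩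
  | insert c s _ ih =>
    obtain ⟨M, h1, h2, h3, h4, h5⟩ := ih
    refine ⟨fun w => M w ∨ ¬F w ∧ κ w = c ∧ ¬M (shift 1 w) ∧ ¬M (shift (-1) w),
      h1.or (hF.not.and ((hκ.comp (· = c)).and ((h1.shift 1).not.and (h1.shift (-1)).not))),
      fun w h => Or.inl (h2 w h), ?_, ?_, ?_⟩
    · rintro w (h | h)
      exacts [h3 w h, h.1]
    · rintro w (h | ⟨hF1, hc1, hs1, hp1⟩) (h' | ⟨hF2, hc2, hs2, hp2⟩)
      · exact h4 w h h'
      · simp at hp2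
        exact hp2 h
      · exact hs1 h'
      · exact hcol w hF1 hF2 (hc1.trans hc2.symm)
    · intro w hw hc hM
      push Not at hM
      rcases Finset.mem_insert.1 hc with rfl | hc
      · by_cases hs : M (shift 1 w)
        · exact Or.inl (Or.inl hs)
        · exact Or.inr (Or.inl (hM.2 hw rfl hs))
      · rcases h5 w hw hc hM.1 with h | h
        exacts [Or.inl (Or.inl h), Or.inr (Or.inl h)]

end Local

/-! ## Iterated evaluation of an idempotent operation -/

section StarPower

variable {A : Type*} {n : ℕ} [NeZero n]

/-- Prepend a letter to a sequence. -/
def consSeq {S : Type*} (j : S) (w : ℕ → S) : ℕ → S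
  | 0 => j
  | k + 1 => w k

/-- The `m`-th star power of the operation `T`, applied to the values of a function on words. -/
def starEval (T : (Fin n → A) → A) : ℕ → ((ℕ → Fin n) → A) → A
  -- The padding by `0` is immaterial once `f` depends only on a prefix of length at most `m`.
  | 0, f => f fun _ => 0
  | m + 1, f => T fun j => starEval T m fun w => f (consSeq j w)

/-- The word consisting of the first `p` letters of `w`, followed by `v`. -/
def splice {S : Type*} (p : ℕ) (w v : ℕ → S) : ℕ → S :=
  fun k => if k < p then w k else v (k - p)

variable {T : (Fin n → A) → A}

theorem consSeq_splice {S : Type*} (j : S) (p : ℕ) (w v : ℕ → S) :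
    consSeq j (splice p w v) = splice (p + 1) (consSeq j w) v := by
  funext k
  cases k with
  | zero => simp [consSeq, splice]
  | succ k => simp [consSeq, splice]

theorem starEval_add (p m : ℕ) (f : (ℕ → Fin n) → A) :
    starEval T (p + m) f = starEval T p fun w => starEval T m fun v => f (splice p w v) := by
  induction p generalizing f with
  | zero =>
    rw [Nat.zero_add]
    have (v : ℕ → Fin n) : splice 0 (fun _ => 0) v = v := by
      funext k
      simp [splice]
    simp only [starEval, this]
  | succ p ih =>
    rw [Nat.succ_add]
    simp only [starEval]
    congr 1
    funext j
    rw [ih]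
    simp only [consSeq_splice]

theorem starEval_rel {E : A → A → Prop}
    (hE : ∀ x y : Fin n → A, (∀ i, E (x i) (y i)) → E (T x) (T y)) (m : ℕ)
    {f g : (ℕ → Fin n) → A} (h : ∀ w, E (f w) (g w)) : E (starEval T m f) (starEval T m g) := by
  induction m generalizing f g with
  | zero => exact h _
  | succ m ih => exact hE _ _ fun j => ih fun w => h _

theorem starEval_const (hT : ∀ a, T (fun _ => a) = a) (m : ℕ) (a : A) :
    starEval T m (fun _ => a) = a := by
  induction m with
  | zero => rfl
  | succ m ih => simp only [starEval, ih, hT]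

/-- Letters beyond those that `f` depends on are irrelevant. -/
theorem starEval_succ_of_prefix (hT : ∀ a, T (fun _ => a) = a) (m : ℕ) {f : (ℕ → Fin n) → A}
    (hf : ∀ w w' : ℕ → Fin n, (∀ k < m, w k = w' k) → f w = f w') :
    starEval T (m + 1) f = starEval T m f := by
  rw [starEval_add]
  congr 1
  funext w
  have : (fun v => f (splice m w v)) = fun _ => f w := by
    funext v
    exact hf _ _ fun k hk => by simp [splice, hk]
  rw [this, starEval_const hT]

/-- An irrelevant first letter may be dropped. -/
theorem starEval_succ_tail (hT : ∀ a, T (fun _ => a) = a) (m : ℕ) (f : (ℕ → Fin n) → A) :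
    starEval T (m + 1) (fun w => f fun k => w (k + 1)) = starEval T m f := by
  simp [starEval, consSeq, hT]

end StarPower


/-! ### The local loop lemma -/

section LocalLoop

variable {A : Type*} {n : ℕ} [NeZero n] {T : (Fin n → A) → A} {E : A → A → Prop}

/-- A loop from a local labelling of sequences: stepping one position to the right follows an edge,
unless the past determines an index `i` such that the label moves from `x i i` to `x i j` where `j`
is the letter that is read. -/
theorem exists_loop_of_local (hT : ∀ a, T (fun _ => a) = a)
    (hE : ∀ x y : Fin n → A, (∀ i, E (x i) (y i)) → E (T x) (T y)) {x : Fin n → Fin n → A}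
    (hx : ∀ i, E (x i i) (T (x i))) {f : (ℤ → Fin n) → A} (hf : IsLocal f)
    (hstep : ∀ w : ℤ → Fin n,
      (∀ w' : ℤ → Fin n, (∀ z ≤ 0, w' z = w z) → E (f w') (f (shift 1 w'))) ∨
      ∃ i, ∀ w' : ℤ → Fin n, (∀ z ≤ 0, w' z = w z) →
        f w' = x i i ∧ f (shift 1 w') = x i (w' 1)) :
    ∃ a, E a a := by
  obtain ⟨k, hk⟩ := hf
  -- Letter `p` of a word sits at position `p - k`, so the first `k + 1` letters are the past up to
  -- position `0`; truncation repeats the first letter further left.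
  let ρ : (ℕ → Fin n) → ℤ → Fin n := fun v z => v (z + k).toNat
  let g : (ℕ → Fin n) → A := fun v => f (ρ v)
  -- A window has `2 * k + 1` letters, so it and its shift fit into `2 * k + 2`. One ignores the
  -- last letter, the other the first, and idempotence gives both the same value.
  have hpre : starEval T (2 * k + 2) g = starEval T (2 * k + 1) g := by
    refine starEval_succ_of_prefix hT _ fun w w' h => hk _ _ fun z hz => h _ ?_
    rw [abs_le] at hz
    omega
  have htail : starEval T (2 * k + 2) (fun v => f (shift 1 (ρ v))) = starEval T (2 * k + 1) g := by
    rw [← starEval_succ_tail hT (2 * k + 1) g]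
    congr 1
    funext v
    refine hk _ _ fun z hz => ?_
    rw [abs_le] at hz
    change v (z + 1 + k).toNat = v ((z + k).toNat + 1)
    congr 1
    omega
  refine ⟨starEval T (2 * k + 1) g, ?_⟩
  have key : E (starEval T (2 * k + 2) g)
      (starEval T (2 * k + 2) fun v => f (shift 1 (ρ v))) := by
    rw [show 2 * k + 2 = (k + 1) + (k + 1) by ring, starEval_add (k + 1), starEval_add (k + 1)]
    refine starEval_rel hE _ fun u => ?_
    have hsp (v : ℕ → Fin n) : ∀ z ≤ 0, ρ (splice (k + 1) u v) z = ρ u z := by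
      intro z hz
      have : (z + k).toNat < k + 1 := by omega
      simp [ρ, splice, this]
    rcases hstep (ρ u) with h | ⟨i, h⟩
    · exact starEval_rel hE _ fun v => h _ (hsp v)
    -- With the past fixed, the source label is constantly `x i i`, and the target labels `x i j`
    -- evaluate to `T (x i)`; the edge is `hx i`.
    · have h1 : (fun v => g (splice (k + 1) u v)) = fun _ => x i i :=
        funext fun v => (h _ (hsp v)).1
      have h2 : (fun v => f (shift 1 (ρ (splice (k + 1) u v)))) = fun v => x i (v 0) := by
        funext v
        rw [(h _ (hsp v)).2]
        congr 1
        have : (1 + (k : ℤ)).toNat = k + 1 := by omega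
        simp [ρ, splice, this]
      rw [h1, h2, starEval_const hT]
      have h3 : starEval T (k + 1) (fun v => x i (v 0)) = T (x i) := by
        simp only [starEval, consSeq, starEval_const hT]
      rw [h3]
      exact hx i
  rwa [hpre, htail] at key

/-- The last `r` letters up to position `0` coincide. -/
def IsRun {S : Type*} (r : ℕ) (w : ℤ → S) : Prop := ∀ m < r, w (-(m : ℤ)) = w 0

/-- A run of length `r` was broken exactly `d` positions ago. -/
def IsBreak {S : Type*} (r d : ℕ) (w : ℤ → S) : Prop :=
  IsRun r (shift (-(d : ℤ) - 1) w) ∧ w (-(d : ℤ)) ≠ w (-(d : ℤ) - 1)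

theorem IsRun.eq {S : Type*} {r : ℕ} {w : ℤ → S} {e : ℤ} (h : IsRun r (shift e w)) {z : ℤ}
    (h₁ : e - r < z) (h₂ : z ≤ e) : w z = w e := by
  have := h (e - z).toNat (by omega)
  simp only [shift_apply, zero_add] at this
  rw [← this]
  congr 1
  omega

theorem isLocal_isRun {S : Type*} (r : ℕ) : IsLocal (IsRun r : (ℤ → S) → Prop) :=
  IsLocal.forall_lt (fun _ => (IsLocal.eval _).comp₂ (IsLocal.eval 0) Eq) r

theorem isLocal_isBreak {S : Type*} (r d : ℕ) : IsLocal (IsBreak r d : (ℤ → S) → Prop) :=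
  ((isLocal_isRun r).shift _).and ((IsLocal.eval _).comp₂ (IsLocal.eval _) Ne)

theorem isBreak_shift_one {S : Type*} {r d : ℕ} {w : ℤ → S} :
    IsBreak r (d + 1) (shift 1 w) ↔ IsBreak r d w := by
  simp only [IsBreak, shift_shift, shift_apply]
  rw [show -((d + 1 : ℕ) : ℤ) - 1 + 1 = -(d : ℤ) - 1 by push_cast; ring,
    show -((d + 1 : ℕ) : ℤ) + 1 = -(d : ℤ) by push_cast; ring]

/-- Such a run would cover both sides of the break, where the letters differ. -/
theorem IsBreak.not_isRun {S : Type*} {r d : ℕ} {e : ℤ} {w : ℤ → S} (h : IsBreak r d w)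
    (h₁ : e + d + 1 < r) (h₂ : -(d : ℤ) ≤ e) : ¬IsRun r (shift e w) := fun h' =>
  h.2 ((h'.eq (by omega) (by omega)).trans (h'.eq (by omega) (by omega)).symm)

theorem IsBreak.unique {S : Type*} {r d d' : ℕ} {w : ℤ → S} (h : IsBreak r d w)
    (h' : IsBreak r d' w) (hd : d < r) (hd' : d' < r) : d = d' := by
  rcases lt_trichotomy d d' with hlt | rfl | hlt
  · exact absurd h.1 (h'.not_isRun (by omega) (by omega))
  · rfl
  · exact absurd h'.1 (h.not_isRun (by omega) (by omega))

/-- The local loop lemma. An idempotent operation `T` compatible with the digraph `E` forces a loop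
in `E` as soon as each `x i i` has an edge to `T (x i ·)`, where all `x i j` lie in a part of `E`
that has closed walks of lengths `2` and `3` through a vertex `o`. -/
theorem exists_loop (hT : ∀ a, T (fun _ => a) = a)
    (hE : ∀ x y : Fin n → A, (∀ i, E (x i) (y i)) → E (T x) (T y)) {x : Fin n → Fin n → A}
    (hx : ∀ i, E (x i i) (T (x i))) {o a b c : A} (hoa : E o a) (hao : E a o) (hob : E o b)
    (hbc : E b c) (hco : E c o) (hox : ∀ i, E o (x i i)) {N : ℕ} (hN : 0 < N)
    {X : Fin n → Fin n → ℕ → A} (hX0 : ∀ i j, X i j 0 = x i j) (hXN : ∀ i j, X i j N = o)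
    (hX : ∀ i j, ∀ d < N, E (X i j d) (X i j (d + 1))) : ∃ a, E a a := by
  classical
  -- With this length, a break at most `N` positions old excludes a run ending anywhere from the
  -- break to two positions ahead; `hZZ` needs exactly that.
  let r := N + 4
  -- On `F` the label is prescribed: `x i i` on a run of `i`, then the walk `X i j` once `j` has
  -- broken it. The positions in `Z` must carry `o`: the end of such a walk, and the place just
  -- before a run.
  let F : (ℤ → Fin n) → Prop := fun w => IsRun r w ∨ ∃ d < N, IsBreak r d w
  let Z : (ℤ → Fin n) → Prop := fun w => IsBreak r N w ∨ ¬IsRun r w ∧ IsRun r (shift 1 w)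
  let κ : (ℤ → Fin n) → Fin r → Fin n := fun w m => w (-(m : ℤ))
  have hRl : IsLocal (IsRun r : (ℤ → Fin n) → Prop) := isLocal_isRun r
  have hFl : IsLocal F := hRl.or (IsLocal.exists_lt (fun d => isLocal_isBreak r d) N)
  have hZl : IsLocal Z := (isLocal_isBreak r N).or (hRl.not.and (hRl.shift 1))
  have hκl : IsLocal κ := IsLocal.fin_pi fun m => IsLocal.eval _
  have hbr0 : ∀ {w : ℤ → Fin n} {d : ℕ}, d ≤ N → IsBreak r d w → ¬IsRun r w := by
    intro w d hd h
    simpa using h.not_isRun (e := 0) (by omega) (by omega)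
  have hZF : ∀ w, Z w → ¬F w := by
    rintro w (h | ⟨h, h'⟩) (hr | ⟨d, hd, hb⟩)
    · exact hbr0 le_rfl h hr
    · exact absurd (h.unique hb (by omega) (by omega)) (by omega)
    · exact h hr
    · exact hb.not_isRun (by omega) (by omega) h'
  have hZZ : ∀ w, Z w → ¬Z (shift 1 w) := by
    rintro w (h | ⟨h, h'⟩) (h2 | ⟨h2, h3⟩)
    · obtain ⟨N', rfl⟩ : ∃ N', N = N' + 1 := ⟨N - 1, by omega⟩
      exact absurd (h.unique (isBreak_shift_one.1 h2) (by omega) (by omega)) (by omega)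
    · rw [shift_shift] at h3
      exact h.not_isRun (by omega) (by omega) h3
    · exact hbr0 le_rfl h2 h'
    · exact h2 h'
  have hcol : ∀ w, ¬F w → ¬F (shift 1 w) → κ w ≠ κ (shift 1 w) := by
    intro w h _ hκ
    -- Equal colours at neighbouring positions make the last `r` letters constant.
    refine h (Or.inl fun m => ?_)
    induction m with
    | zero => intro _; simp
    | succ m ih =>
      intro hm
      have := congrFun hκ ⟨m + 1, hm⟩
      simp only [κ, shift_apply] at this
      rw [this, ← ih (by omega)]
      congr 1
      push_cast
      ring
  obtain ⟨M, hMl, hZM, hMF, hMM, hmax⟩ :=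
    exists_local_maximal_independent hZl hFl hκl hZF hZZ hcol
  let B : (ℤ → Fin n) → ℕ → A := fun w d => X (w (-(d : ℤ) - 1)) (w (-(d : ℤ))) d
  -- Outside `F`, maximality leaves one or two positions between neighbouring members of `M`; they
  -- are filled along the closed walks o → a → o and o → b → c → o.
  let g : (ℤ → Fin n) → A := fun w =>
    if M w then o else if M (shift (-1) w) then (if M (shift 1 w) then a else b) else c
  let br : ℕ → (ℤ → Fin n) → A := fun m =>
    Nat.rec g (fun d h w => if IsBreak r d w then B w d else h w) m
  let f : (ℤ → Fin n) → A := fun w => if IsRun r w then x (w 0) (w 0) else br N w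
  have hgl : IsLocal g :=
    hMl.ite (.const o) ((hMl.shift _).ite ((hMl.shift _).ite (.const a) (.const b)) (.const c))
  have hbrl : ∀ m, IsLocal (br m) := by
    intro m
    induction m with
    | zero => exact hgl
    | succ d ih =>
      exact (isLocal_isBreak r d).ite
        ((IsLocal.eval _).comp₂ (IsLocal.eval _) fun i j => X i j d) ih
  have hfl : IsLocal f := hRl.ite ((IsLocal.eval 0).comp fun i => x i i) (hbrl N)
  have hbrn : ∀ {w : ℤ → Fin n} (m : ℕ), (∀ d < m, ¬IsBreak r d w) → br m w = g w := by
    intro w m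
    induction m with
    | zero => intro _; rfl
    | succ m ih =>
      intro h
      change (if IsBreak r m w then B w m else br m w) = _
      rw [if_neg (h m (by omega)), ih fun d hd => h d (by omega)]
  have hbrb : ∀ {w : ℤ → Fin n} {d : ℕ} (m : ℕ), m ≤ N → d < m → IsBreak r d w →
      br m w = B w d := by
    intro w d m
    induction m with
    | zero => intro _ h; omega
    | succ m ih =>
      intro hm hd h
      change (if IsBreak r m w then B w m else br m w) = _
      split_ifs with h'
      · rw [h.unique h' (by omega) (by omega)]
      · refine ih (by omega) (lt_of_le_of_ne (by omega) ?_) h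
        rintro rfl
        exact h' h
  have hfR : ∀ {w}, IsRun r w → f w = x (w 0) (w 0) := fun h => if_pos h
  have hfB : ∀ {w d}, d < N → IsBreak r d w → f w = B w d := by
    intro w d hd h
    exact (if_neg (hbr0 hd.le h)).trans (hbrb N le_rfl hd h)
  have hfg : ∀ {w}, ¬F w → f w = g w := by
    intro w h
    exact (if_neg fun h' => h (Or.inl h')).trans (hbrn N fun d hd hb => h (Or.inr ⟨d, hd, hb⟩))
  have hfM : ∀ {w}, M w → f w = o := fun {w} h => (hfg (hMF _ h)).trans (if_pos h)
  -- A break can only follow a run, so `F` is entered only by a run.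
  have hfree : ∀ {w}, ¬F w → ¬IsRun r (shift 1 w) → ¬F (shift 1 w) := by
    rintro w hw hr (h | ⟨d, hd, hb⟩)
    · exact hr h
    · cases d with
      | zero =>
        refine hw (Or.inl ?_)
        simpa using hb.1
      | succ d => exact hw (Or.inr ⟨d, by omega, isBreak_shift_one.1 hb⟩)
  have hback : ∀ w : ℤ → Fin n, shift (-1) (shift 1 w) = w := fun w => by simp
  have hedge : ∀ w, ¬IsRun r w → E (f w) (f (shift 1 w)) := by
    intro w hr
    by_cases hF : F w
    · obtain ⟨d, hd, hb⟩ := hF.resolve_left hr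
      have hb' := isBreak_shift_one.2 hb
      have hB : B (shift 1 w) (d + 1) = X (w (-(d : ℤ) - 1)) (w (-(d : ℤ))) (d + 1) := by
        simp only [B, shift_apply]
        congr 2 <;> push_cast <;> ring
      have he := hX (w (-(d : ℤ) - 1)) (w (-(d : ℤ))) d hd
      rw [hfB hd hb]
      rcases Nat.lt_or_ge (d + 1) N with hd' | hd'
      · rw [hfB hd' hb', hB]
        exact he
      · obtain rfl : N = d + 1 := by omega
        rw [hfM (hZM _ (Or.inl hb')), ← hXN (w (-(d : ℤ) - 1)) (w (-(d : ℤ)))]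
        exact he
    by_cases hM : M w
    · rw [hfM hM]
      by_cases hr' : IsRun r (shift 1 w)
      · rw [hfR hr']
        exact hox _
      rw [hfg (hfree hF hr')]
      simp only [g, hback, if_neg (hMM w hM), if_pos hM]
      split_ifs
      exacts [hoa, hob]
    have hr' : ¬IsRun r (shift 1 w) := fun h => hM (hZM _ (Or.inr ⟨hr, h⟩))
    rw [hfg hF]
    by_cases hp : M (shift (-1) w) <;> by_cases hs : M (shift 1 w)
    · rw [hfM hs]
      simpa only [g, if_neg hM, if_pos hp, if_pos hs] using hao
    · rw [hfg (hfree hF hr')]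
      simpa only [g, hback, if_neg hM, if_pos hp, if_neg hs] using hbc
    · rw [hfM hs]
      simpa only [g, if_neg hM, if_neg hp] using hco
    · exact absurd (hmax w hF hM) (by tauto)
  refine exists_loop_of_local hT hE hx hfl fun w => ?_
  have hRw : ∀ w' : ℤ → Fin n, (∀ z ≤ 0, w' z = w z) → (IsRun r w' ↔ IsRun r w) := by
    intro w' h
    refine forall₂_congr fun m _ => ?_
    rw [h _ (by omega), h 0 le_rfl]
  by_cases hr : IsRun r w
  · refine Or.inr ⟨w 0, fun w' h => ?_⟩
    have hr' := (hRw w' h).2 hr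
    rw [hfR hr', h 0 le_rfl]
    refine ⟨rfl, ?_⟩
    -- A continued run keeps the label `x i i`; a run broken by `j` moves to `X i j 0 = x i j`.
    -- Either way the new label is `x i (w' 1)`.
    by_cases h1 : w' 1 = w 0
    · rw [hfR, shift_apply, zero_add, h1]
      intro m hm
      cases m with
      | zero => simp
      | succ m =>
        have := hr' m (by omega)
        simp only [shift_apply]
        rw [zero_add, h1, ← h 0 le_rfl, ← this]
        congr 1
        push_cast
        ring
    · have hb : IsBreak r 0 (shift 1 w') := by
        refine ⟨by simpa using hr', ?_⟩
        simpa [h 0 le_rfl] using h1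
      rw [hfB hN hb]
      simp [B, hX0, h 0 le_rfl]
  · exact Or.inl fun w' h => hedge w' (mt (hRw w' h).1 hr)

end LocalLoop


open FirstOrder FirstOrder.Language

/-! ## Congruences: meets, joins and term operations -/

namespace Congruence

variable {L : FirstOrder.Language.{u, v}} {A : Type w} [L.Structure A]

theorem rel_sInf {S : Set (Congruence L A)} {a b : A} (h : ∀ θ ∈ S, θ.Rel a b) :
    (sInf S).Rel a b := h

theorem rel_inf {θ φ : Congruence L A} {a b : A} (h : θ.Rel a b) (h' : φ.Rel a b) :
    (θ ⊓ φ).Rel a b := by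
  rw [← sInf_pair]
  refine rel_sInf ?_
  rintro ψ (rfl | rfl)
  exacts [h, h']

theorem rel_iInf {ι : Sort*} {θ : ι → Congruence L A} {a b : A} (h : ∀ i, (θ i).Rel a b) :
    (⨅ i, θ i).Rel a b := by
  refine rel_sInf ?_
  rintro ψ ⟨i, rfl⟩
  exact h i

theorem rel_realize (θ : Congruence L A) {X : Type*} (t : L.Term X) {x y : X → A}
    (h : ∀ i, θ.Rel (x i) (y i)) : θ.Rel (t.realize x) (t.realize y) := by
  induction t with
  | var i => exact h i
  | func f ts ih => exact θ.map_funMap f _ _ ih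

/-- The congruence generated by a set of congruences, as a transitive closure. -/
def eqvGen (S : Set (Congruence L A)) : Congruence L A where
  toSetoid := Relation.EqvGen.setoid fun a b => ∃ θ ∈ S, θ.Rel a b
  map_funMap := by
    classical
    intro n f x y h
    -- The chains in different coordinates need not match in length, so the coordinates are changed
    -- one at a time.
    have hone : ∀ (z : Fin n → A) (i : Fin n) (a b : A),
        Relation.EqvGen (fun a b => ∃ θ ∈ S, θ.Rel a b) a b →
        Relation.EqvGen (fun a b => ∃ θ ∈ S, θ.Rel a b)
          (Structure.funMap f (Function.update z i a))
          (Structure.funMap f (Function.update z i b)) := by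
      intro z i a b hab
      induction hab with
      | rel a b hab =>
        obtain ⟨θ, hθ, hab⟩ := hab
        refine .rel _ _ ⟨θ, hθ, θ.map_funMap f _ _ fun j => ?_⟩
        by_cases hj : j = i
        · subst hj
          simpa using (show θ.toSetoid a b from hab)
        · simp [hj]
      | refl a => exact .refl _
      | symm a b _ ih => exact .symm _ _ ih
      | trans a b c _ _ ih ih' => exact .trans _ _ _ ih ih'
    have hall : ∀ s : Finset (Fin n), Relation.EqvGen (fun a b => ∃ θ ∈ S, θ.Rel a b)
        (Structure.funMap f x) (Structure.funMap f (s.piecewise y x)) := by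
      intro s
      induction s using Finset.induction_on with
      | empty => simpa using .refl _
      | insert i s hi ih =>
        refine .trans _ _ _ ih ?_
        rw [Finset.piecewise_insert]
        have := hone (s.piecewise y x) i (x i) (y i) (h i)
        rwa [show Function.update (s.piecewise y x) i (x i) = s.piecewise y x from
          Function.update_eq_self_iff.2 (by simp [hi])] at this
    have := hall Finset.univ
    rwa [Finset.piecewise_univ] at this

theorem eqvGen_of_rel_sSup {S : Set (Congruence L A)} {a b : A} (h : (sSup S).Rel a b) :
    Relation.EqvGen (fun a b => ∃ θ ∈ S, θ.Rel a b) a b := by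
  have : sSup S ≤ eqvGen S := sSup_le fun θ hθ a b hab => .rel _ _ ⟨θ, hθ, hab⟩
  exact this a b h

end Congruence

namespace Variety

variable {L : FirstOrder.Language.{u, v}} {V : Variety L}

theorem isIdempotent_iff {n : ℕ} {t : L.Term (Fin n)} :
    IsIdempotent.{u, v, w} V t ↔
      ∀ (A : Type (max u w)) [L.Structure A], V.Mem A → ∀ a : A, t.realize (fun _ => a) = a := by
  refine ⟨fun h A _ hA a => ?_, fun h A _ hA x => ?_⟩
  · have := h A hA fun _ => a
    rwa [Term.realize_relabel] at this
  · rw [Term.realize_relabel]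
    exact h A hA (x 0)

/-! ## Free algebras of a variety -/

variable (V) in
/-- Satisfaction of `p ≈ q` in `V`, as an equivalence relation on terms. -/
def termSetoid (X : Type) : Setoid (L.Term X) where
  r p q := Satisfies.{u, v, w} V p q
  iseqv :=
    { refl := fun _ _ _ _ _ => rfl
      symm := fun h A _ hA x => (h A hA x).symm
      trans := fun h h' A _ hA x => (h A hA x).trans (h' A hA x) }

variable (V) in
/-- The algebra of `V` freely generated by `X`. -/
def Free (X : Type) : Type (max u w) := ULift.{w} (Quotient (termSetoid.{u, v, w} V X))

namespace Free

variable {X Y : Type}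

/-- The element of the free algebra given by a term. -/
def mk (p : L.Term X) : Free.{u, v, w} V X := ⟨Quotient.mk (termSetoid.{u, v, w} V X) p⟩

/-- A term representing an element of the free algebra. -/
noncomputable def rep (e : Free.{u, v, w} V X) : L.Term X := e.down.out

@[simp] theorem mk_rep (e : Free.{u, v, w} V X) : mk (rep e) = e :=
  congrArg ULift.up (Quotient.out_eq e.down)

theorem mk_eq_mk {p q : L.Term X} :
    (mk p : Free.{u, v, w} V X) = mk q ↔ Satisfies.{u, v, w} V p q := by
  refine ⟨fun h => ?_, fun h => congrArg ULift.up (Quotient.sound h)⟩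
  exact Quotient.exact (congrArg ULift.down h)

noncomputable instance : L.Structure (Free.{u, v, w} V X) where
  funMap f xs := mk (.func f fun i => rep (xs i))
  -- Terms and congruences see only operations, so any interpretation of relation symbols serves.
  RelMap _ _ := False

theorem realize_mk (p : L.Term X) (s : X → L.Term Y) :
    p.realize (fun i => (mk (s i) : Free.{u, v, w} V Y)) = mk (p.subst s) := by
  induction p with
  | var i => rfl
  | func f ts ih =>
    refine mk_eq_mk.2 fun A _ hA x => ?_
    simp only [Term.realize_func, Term.subst]
    congr 1
    funext i
    refine mk_eq_mk.1 ?_ A hA x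
    rw [mk_rep]
    exact ih i

/-- The free generators. -/
def gen (i : X) : Free.{u, v, w} V X := mk (.var i)

theorem realize_gen (p : L.Term X) (σ : X → Y) :
    p.realize (fun i => (gen (σ i) : Free.{u, v, w} V Y)) = mk (p.relabel σ) := by
  refine (realize_mk p fun i => .var (σ i)).trans (mk_eq_mk.2 fun A _ _ x => ?_)
  rw [Term.realize_subst, Term.realize_relabel]
  rfl

/-- Elements are classes of terms modulo satisfaction in `V`, and substitution instances of defining
identities hold in all members. The `ULift` places the free algebra in the universe over which
`Satisfies` quantifies. -/
theorem mem : V.Mem (Free.{u, v, w} V X) := by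
  intro e he x
  have hx : x = fun i => mk (rep (x i)) := by
    funext i
    simp
  rw [hx, realize_mk, realize_mk, mk_eq_mk]
  intro A _ hA y
  rw [Term.realize_subst, Term.realize_subst]
  exact hA e he _

end Free

/-! ## From a Taylor term to a six-ary term -/

theorem IsIdempotent.subst {n m : ℕ} {t : L.Term (Fin n)} (ht : IsIdempotent.{u, v, w} V t)
    {s : Fin n → L.Term (Fin m)} (hs : ∀ i, IsIdempotent.{u, v, w} V (s i)) :
    IsIdempotent.{u, v, w} V (t.subst s) := by
  rw [isIdempotent_iff] at ht ⊢
  intro A _ hA a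
  rw [Term.realize_subst]
  simp only [fun i => isIdempotent_iff.1 (hs i) A hA a, ht A hA]

theorem isIdempotent_var {n : ℕ} (i : Fin n) :
    IsIdempotent.{u, v, w} V (.var i : L.Term (Fin n)) := fun _ _ _ _ => rfl

/-- The ternary relation on the free algebra on two generators that is generated, under idempotent
terms, by the nonconstant triples of generators. -/
def OlsakRel (a b c : Free.{u, v, w} V (Fin 2)) : Prop :=
  ∃ s : L.Term (Fin 6), IsIdempotent.{u, v, w} V s ∧
    s.realize (fun i => Free.gen ((![0, 1, 1, 1, 0, 0] : Fin 6 → Fin 2) i)) = a ∧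
    s.realize (fun i => Free.gen ((![1, 0, 1, 0, 1, 0] : Fin 6 → Fin 2) i)) = b ∧
    s.realize (fun i => Free.gen ((![1, 1, 0, 0, 0, 1] : Fin 6 → Fin 2) i)) = c

theorem hasOlsakTerm_of_olsakRel {a : Free.{u, v, w} V (Fin 2)} (h : OlsakRel a a a) :
    HasOlsakTerm.{u, v, w} V := by
  obtain ⟨s, hs, h1, h2, h3⟩ := h
  rw [Free.realize_gen] at h1 h2 h3
  exact ⟨s, hs, Free.mk_eq_mk.1 (h1.trans h2.symm), Free.mk_eq_mk.1 (h2.trans h3.symm)⟩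

theorem OlsakRel.realize {n : ℕ} {t : L.Term (Fin n)} (ht : IsIdempotent.{u, v, w} V t)
    {a b c : Fin n → Free.{u, v, w} V (Fin 2)} (h : ∀ i, OlsakRel (a i) (b i) (c i)) :
    OlsakRel (t.realize a) (t.realize b) (t.realize c) := by
  choose s hs h1 h2 h3 using h
  refine ⟨t.subst s, ht.subst hs, ?_, ?_, ?_⟩ <;> rw [Term.realize_subst]
  · simp only [h1]
  · simp only [h2]
  · simp only [h3]

/-- The columns of the three argument patterns are precisely the six nonconstant triples. -/
theorem olsakRel_gen {i j k : Fin 2} (h : ¬(i = j ∧ j = k)) :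
    OlsakRel (Free.gen i : Free.{u, v, w} V (Fin 2)) (Free.gen j) (Free.gen k) := by
  obtain ⟨m, rfl, rfl, rfl⟩ : ∃ m : Fin 6, (![0, 1, 1, 1, 0, 0] : Fin 6 → Fin 2) m = i ∧
      (![1, 0, 1, 0, 1, 0] : Fin 6 → Fin 2) m = j ∧
      (![1, 1, 0, 0, 0, 1] : Fin 6 → Fin 2) m = k := by
    revert i j k
    decide
  exact ⟨.var m, isIdempotent_var m, rfl, rfl, rfl⟩

theorem IsTaylor.hasOlsakTerm (h : IsTaylor.{u, v, w} V) : HasOlsakTerm.{u, v, w} V := by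
  obtain ⟨n, hn, t, ht, x₀, y₀, hxy₀, heq₀⟩ := h
  have : NeZero n := ⟨by omega⟩
  let F := Free.{u, v, w} V (Fin 2)
  have hF : V.Mem F := Free.mem
  -- orient the equations
  obtain ⟨x, y, hx, hy, heq⟩ : ∃ x y : Fin n → Fin n → Fin 2, (∀ i, x i i = 0) ∧
      (∀ i, y i i = 1) ∧ ∀ i, t.realize (fun j => (Free.gen (x i j) : F)) =
        t.realize fun j => (Free.gen (y i j) : F) := by
    have : ∀ i, ∃ x y : Fin n → Fin 2, x i = 0 ∧ y i = 1 ∧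
        t.realize (fun j => (Free.gen (x j) : F)) = t.realize fun j => (Free.gen (y j) : F) := by
      intro i
      have he := Free.mk_eq_mk.2 (heq₀ i)
      rw [← Free.realize_gen, ← Free.realize_gen] at he
      have hne := hxy₀ i
      by_cases h0 : x₀ i i = 0
      · exact ⟨x₀ i, y₀ i, h0, by omega, he⟩
      · exact ⟨y₀ i, x₀ i, by omega, by omega, he.symm⟩
    choose x y h1 h2 h3 using this
    exact ⟨x, y, h1, h2, h3⟩
  have hid : ∀ a : F, t.realize (fun _ : Fin n => a) = a := isIdempotent_iff.1 ht F hF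
  let g : Fin 2 → F := Free.gen
  let q : Fin n → F := fun i => t.realize fun j => g (x i j)
  have hg : ∀ {i j k : Fin 2}, ¬(i = j ∧ j = k) → OlsakRel (g i) (g j) (g k) := olsakRel_gen
  -- `q i` may replace a generator between distinct generators
  have hq1 : ∀ i j k, j ≠ k → OlsakRel (q i) (g j) (g k) := by
    intro i j k hjk
    have := OlsakRel.realize ht (a := fun l => g (x i l)) (b := fun _ => g j) (c := fun _ => g k)
      fun l => hg (by tauto)
    rwa [hid, hid] at this
  have hq2 : ∀ i j k, j ≠ k → OlsakRel (g j) (q i) (g k) := by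
    intro i j k hjk
    have := OlsakRel.realize ht (b := fun l => g (x i l)) (a := fun _ => g j) (c := fun _ => g k)
      fun l => hg (by intro h; exact hjk (h.1.trans h.2))
    rwa [hid, hid] at this
  have hq3 : ∀ i j k, j ≠ k → OlsakRel (g j) (g k) (q i) := by
    intro i j k hjk
    have := OlsakRel.realize ht (c := fun l => g (x i l)) (a := fun _ => g j) (b := fun _ => g k)
      fun l => hg (by tauto)
    rwa [hid, hid] at this
  -- Off the diagonal `w` negates `y`, so the triple (0, `y i j`, `w i j`) is never constant; on the
  -- diagonal it is (0, 1, `q i`). Applying `t` gives `hw`, since `t` has the value `q i` on the row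
  -- `y i` too: this is where the Taylor equations enter.
  let w : Fin n → Fin n → F := fun i j => if j = i then q i else if y i j = 0 then g 1 else g 0
  have hwi : ∀ i, w i i = q i := fun i => if_pos rfl
  have hw : ∀ i, OlsakRel (g 0) (q i) (t.realize (w i)) := by
    intro i
    have := OlsakRel.realize ht (a := fun _ => g 0) (b := fun j => g (y i j)) (c := w i) ?_
    · rw [hid] at this
      simpa only [q, g, heq i] using this
    · intro j
      by_cases hj : j = i
      · subst hj
        rw [hwi, hy]
        exact hq3 j 0 1 (by decide)
      · simp only [w, if_neg hj]
        split_ifs with h0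
        · rw [h0]
          exact hg (by decide)
        · rw [show y i j = 1 by omega]
          exact hg (by decide)
  -- In this digraph `hw i` is the edge from (`x i i`, `w i i`) = (0, `q i`) to the value of `T` on
  -- row `i`.
  let E : F × F → F × F → Prop := fun p r => p.2 = r.1 ∧ OlsakRel p.1 p.2 r.2
  let T : (Fin n → F × F) → F × F := fun p =>
    (t.realize fun j => (p j).1, t.realize fun j => (p j).2)
  have hEg : ∀ {i j k : Fin 2}, ¬(i = j ∧ j = k) → E (g i, g j) (g j, g k) :=
    fun h => ⟨rfl, hg h⟩
  -- walks of length four from the vertices `(x i j, w i j)` to `(1, 0)`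
  have hwalk : ∀ i j, ∃ X : ℕ → F × F, X 0 = (g (x i j), w i j) ∧ X 4 = (g 1, g 0) ∧
      ∀ d < 4, E (X d) (X (d + 1)) := by
    intro i j
    have mkw : ∀ p₀ p₁ p₂ p₃ p₄ : F × F, E p₀ p₁ → E p₁ p₂ → E p₂ p₃ → E p₃ p₄ →
        ∃ X : ℕ → F × F, X 0 = p₀ ∧ X 4 = p₄ ∧ ∀ d < 4, E (X d) (X (d + 1)) := by
      intro p₀ p₁ p₂ p₃ p₄ h0 h1 h2 h3
      refine ⟨fun d => match d with | 0 => p₀ | 1 => p₁ | 2 => p₂ | 3 => p₃ | _ => p₄, rfl, rfl, ?_⟩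
      intro d hd
      interval_cases d
      exacts [h0, h1, h2, h3]
    have h10 : E (g 1, g 0) (g 0, g 1) := hEg (by decide)
    have h01 : E (g 0, g 1) (g 1, g 0) := hEg (by decide)
    by_cases hj : j = i
    · subst hj
      rw [hx, hwi]
      exact mkw _ (q j, g 1) (g 1, g 0) (g 0, g 1) _ ⟨rfl, hq2 j 0 1 (by decide)⟩
        ⟨rfl, hq1 j 1 0 (by decide)⟩ h10 h01
    · obtain ⟨l, hl⟩ : ∃ l, w i j = g l := by
        simp only [w, if_neg hj]
        split_ifs
        exacts [⟨1, rfl⟩, ⟨0, rfl⟩]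
      rw [hl]
      generalize x i j = k
      have hcases : ∀ k l : Fin 2, (k = 0 ∧ l = 0) ∨ (k = 0 ∧ l = 1) ∨ (k = 1 ∧ l = 0) ∨
        (k = 1 ∧ l = 1) := by decide
      rcases hcases k l with ⟨rfl, rfl⟩ | ⟨rfl, rfl⟩ | ⟨rfl, rfl⟩ | ⟨rfl, rfl⟩
      · exact mkw _ (g 0, g 1) (g 1, g 0) (g 0, g 1) _ (hEg (by decide)) h01 h10 h01
      · exact mkw _ (g 1, g 0) (g 0, g 0) (g 0, g 1) _ h01 (hEg (by decide)) (hEg (by decide)) h01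
      · exact mkw _ (g 0, g 1) (g 1, g 0) (g 0, g 1) _ h10 h01 h10 h01
      · exact mkw _ (g 1, g 0) (g 0, g 0) (g 0, g 1) _ (hEg (by decide)) (hEg (by decide))
          (hEg (by decide)) h01
  choose X hX0 hX4 hX using hwalk
  obtain ⟨⟨a, b⟩, hab, hR⟩ := exists_loop (T := T) (E := E)
    (fun p => Prod.ext (hid p.1) (hid p.2))
    (fun p r h => ⟨congrArg t.realize (funext fun i => (h i).1),
      OlsakRel.realize ht fun i => (h i).2⟩)
    (x := fun i j => (g (x i j), w i j))
    (fun i => by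
      refine ⟨hwi i, ?_⟩
      change OlsakRel (g (x i i)) (w i i) (t.realize (w i))
      rw [hx, hwi]
      exact hw i)
    -- The closed walks are 10 → 01 → 10 and 10 → 00 → 01 → 10.
    (o := (g 1, g 0)) (a := (g 0, g 1)) (b := (g 0, g 0)) (c := (g 0, g 1))
    (hEg (by decide)) (hEg (by decide)) (hEg (by decide)) (hEg (by decide)) (hEg (by decide))
    (fun i => by
      rw [hx, hwi]
      exact ⟨rfl, hq3 i 1 0 (by decide)⟩)
    (N := 4) (by norm_num) hX0 hX4 hX
  obtain rfl : b = a := hab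
  exact hasOlsakTerm_of_olsakRel hR

/-- No column of the patterns is constant, so at each place the first two rows differ or the last
two do. -/
theorem HasOlsakTerm.isTaylor (h : HasOlsakTerm.{u, v, w} V) : IsTaylor.{u, v, w} V := by
  obtain ⟨t, ht, h1, h2⟩ := h
  let p₁ : Fin 6 → Fin 2 := ![0, 1, 1, 1, 0, 0]
  let p₂ : Fin 6 → Fin 2 := ![1, 0, 1, 0, 1, 0]
  let p₃ : Fin 6 → Fin 2 := ![1, 1, 0, 0, 0, 1]
  refine ⟨6, by norm_num, t, ht, fun i => if p₁ i ≠ p₂ i then p₁ else p₂,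
    fun i => if p₁ i ≠ p₂ i then p₂ else p₃, by decide, fun i => ?_⟩
  dsimp only
  split_ifs
  exacts [h1, h2]

/-! ## From the six-ary term to the congruence inclusion -/

/-- The link is t(c). Idempotence relates a to t(c) by ⋁αᵢ and t(c) to b by ⋁βᵢ. Moving each cᵢ to a
along αᵢ or to b along βᵢ, as the patterns prescribe, relates t(c) to the common value q by both θₖ;
and a γ q because a γ b. -/
theorem HasOlsakTerm.satisfiesTaylorInclusion (h : HasOlsakTerm.{u, v, w} V) :
    SatisfiesTaylorInclusion.{u, v, w} V := by
  obtain ⟨t, ht, h1, h2⟩ := h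
  intro A _ hA α β a b hab
  choose c hac hcb using hab
  have hid := isIdempotent_iff.1 ht A hA
  have e1 := h1 A hA ![a, b]
  have e2 := h2 A hA ![a, b]
  simp only [Term.realize_relabel] at e1 e2
  have hpj : ∀ (S S' : Finset (Fin 6)) (p : Fin 6 → Fin 2),
      (∀ i, p i = 0 ∧ i ∈ S ∨ p i = 1 ∧ i ∈ S') →
      (partialJoin α β S S').Rel (t.realize c) (t.realize (![a, b] ∘ p)) := by
    intro S S' p hp
    refine Congruence.rel_realize _ _ fun i => ?_
    rcases hp i with ⟨hp, hi⟩ | ⟨hp, hi⟩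
    · have hle : α i ≤ partialJoin α β S S' := 
        (le_iSup₂ (f := fun j (_ : j ∈ S) => α j) i hi).trans le_sup_left
      simpa [hp] using Congruence.rel_symm _ (hle _ _ (hac i))
    · have hle : β i ≤ partialJoin α β S S' := 
        (le_iSup₂ (f := fun j (_ : j ∈ S') => β j) i hi).trans le_sup_right
      simpa [hp] using hle _ _ (hcb i)
  have hL := hpj {0, 4, 5} {1, 2, 3} ![0, 1, 1, 1, 0, 0] (by decide)
  have hR₁ := hpj {1, 3, 5} {0, 2, 4} ![1, 0, 1, 0, 1, 0] (by decide)
  have hR₂ := hpj {2, 3, 4} {0, 1, 5} ![1, 1, 0, 0, 0, 1] (by decide)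
  rw [← e1] at hR₁
  rw [← e2, ← e1] at hR₂
  set q := t.realize (![a, b] ∘ ![0, 1, 1, 1, 0, 0])
  have hab : (gamma α β).Rel a b := Congruence.rel_iInf fun i =>
    Congruence.rel_trans _ ((le_sup_left : α i ≤ _) _ _ (hac i))
      ((le_sup_right : β i ≤ _) _ _ (hcb i))
  have haq : (gamma α β).Rel a q := by
    have := (gamma α β).rel_realize t (x := fun _ => a)
      (y := ![a, b] ∘ (![0, 1, 1, 1, 0, 0] : Fin 6 → Fin 2)) fun i => by
        have : ∀ k : Fin 2, (gamma α β).Rel a (![a, b] k) := by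
          intro k
          fin_cases k
          exacts [Congruence.rel_refl _ _, hab]
        exact this _
    rwa [hid] at this
  have hθ : ∀ θ : Congruence L A, θ.Rel (t.realize c) q →
      (gamma α β ⊔ θ).Rel a (t.realize c) := fun θ h =>
    Congruence.rel_trans _ ((le_sup_left : gamma α β ≤ _) _ _ haq)
      ((le_sup_right : θ ≤ _) _ _ (Congruence.rel_symm _ h))
  have hψ : ((gamma α β ⊔ theta₁ α β) ⊓ (gamma α β ⊔ theta₂ α β)).Rel a (t.realize c) :=
    Congruence.rel_inf (hθ _ (Congruence.rel_inf hL hR₁)) (hθ _ (Congruence.rel_inf hL hR₂))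
  have hψ' : ((gamma α β ⊔ theta₁ α β) ⊓ (gamma α β ⊔ theta₂ α β)).Rel (t.realize c) b :=
    Congruence.rel_trans _ (Congruence.rel_symm _ hψ)
      (Congruence.rel_inf ((le_sup_left : gamma α β ≤ _) _ _ hab)
        ((le_sup_left : gamma α β ≤ _) _ _ hab))
  have hα : (⨆ i, α i).Rel a (t.realize c) := by
    have := Congruence.rel_realize (⨆ i, α i) t (x := fun _ => a) (y := c) fun i =>
      le_iSup α i _ _ (hac i)
    rwa [hid] at this
  have hβ : (⨆ i, β i).Rel (t.realize c) b := by
    have := Congruence.rel_realize (⨆ i, β i) t (y := fun _ => b) (x := c) fun i =>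
      le_iSup β i _ _ (hcb i)
    rwa [hid] at this
  exact Congruence.rel_trans _
    ((le_sup_left : _ ≤ taylorRhs α β) _ _ (Congruence.rel_inf hα hψ))
    ((le_sup_right : _ ≤ taylorRhs α β) _ _ (Congruence.rel_inf hβ hψ'))

end Variety


open FirstOrder FirstOrder.Language

namespace Variety

variable {L : FirstOrder.Language.{u, v}} {V : Variety L}

/-! ## Star composition and minor-compatible choices of variables -/

/-- Finitely many idempotent terms are minors of a single idempotent term. -/
theorem exists_star_composition {k m : ℕ} (p : Fin m → L.Term (Fin k)) (hk : 0 < k)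
    (hp : ∀ a, IsIdempotent.{u, v, w} V (p a)) :
    ∃ s : L.Term (Fin m → Fin k),
      (∀ (A : Type (max u w)) [L.Structure A], V.Mem A → ∀ a : A, s.realize (fun _ => a) = a) ∧
      ∀ (A : Type (max u w)) [L.Structure A], V.Mem A → ∀ (a : Fin m) (x : Fin k → A),
        s.realize (fun i => x (i a)) = (p a).realize x := by
  induction m with
  | zero => exact ⟨.var fun _ => ⟨0, hk⟩, fun _ _ _ _ => rfl, fun _ _ _ a => a.elim0⟩
  | succ m ih =>
    obtain ⟨s, hs, hsp⟩ := ih (fun a => p a.succ) fun a => hp a.succ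
    -- `p 0` acts on the first coordinate of the tuples and `s` on the others, so when only one
    -- coordinate is read, idempotence removes the other factor.
    refine ⟨(p 0).subst fun l => s.relabel fun i => Fin.cons l i, ?_, ?_⟩
    · intro A _ hA a
      simp only [Term.realize_subst, Term.realize_relabel, Function.comp_def, hs A hA]
      exact isIdempotent_iff.1 (hp 0) A hA a
    · intro A _ hA a x
      simp only [Term.realize_subst, Term.realize_relabel, Function.comp_def]
      cases a using Fin.cases with
      | zero => simp only [Fin.cons_zero, hs A hA]
      | succ a =>
        simp only [Fin.cons_succ, hsp A hA]
        exact isIdempotent_iff.1 (hp 0) A hA _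

variable (V) in
/-- A choice of a variable for each idempotent `k`-ary term that is compatible with minors. -/
def IsMinorChoice {k : ℕ} (I : Set (L.Term (Fin k))) (φ : L.Term (Fin k) → Fin k) : Prop :=
  ∀ p ∈ I, ∀ q ∈ I, IsIdempotent.{u, v, w} V p → IsIdempotent.{u, v, w} V q →
    ∀ σ τ : Fin k → Fin k, Satisfies.{u, v, w} V (p.relabel σ) (q.relabel τ) →
      σ (φ p) = τ (φ q)

/-- The variables of the star composition `s` of the idempotent terms in `I` are exactly the choices
`c`. If every choice violated a minor identity, the identity violated by `c` would give a Taylor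
equation for `s` at the place `c`. -/
theorem exists_isMinorChoice_finset (hV : ¬IsTaylor.{u, v, w} V) {k : ℕ} (hk : 0 < k)
    (I : Finset (L.Term (Fin k))) : ∃ φ, IsMinorChoice.{u, v, w} V (I : Set (L.Term (Fin k))) φ := by
  classical
  let J := {p : L.Term (Fin k) // p ∈ I ∧ IsIdempotent.{u, v, w} V p}
  have : Finite J := Finite.of_injective (fun p : J => (⟨p.1, p.2.1⟩ : I)) fun p q h =>
    Subtype.ext (congrArg (fun r : I => r.1) h)
  obtain ⟨m, ⟨e⟩⟩ := Finite.exists_equiv_fin J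
  obtain ⟨s, hs, hsp⟩ := exists_star_composition (fun a => (e.symm a).1) hk fun a =>
    (e.symm a).2.2
  by_contra hcon
  push Not at hcon
  -- every choice of variables violates some minor identity
  have hbad : ∀ c : Fin m → Fin k, ∃ (a b : Fin m) (σ τ : Fin k → Fin k),
      Satisfies.{u, v, w} V ((e.symm a).1.relabel σ) ((e.symm b).1.relabel τ) ∧
        σ (c a) ≠ τ (c b) := by
    intro c
    by_contra h
    push Not at h
    refine hcon (fun p => if hp : p ∈ I ∧ IsIdempotent.{u, v, w} V p then c (e ⟨p, hp⟩)
      else ⟨0, hk⟩) ?_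
    intro p hpI q hqI hp hq σ τ hpq
    have hp' : p ∈ I ∧ IsIdempotent.{u, v, w} V p := ⟨hpI, hp⟩
    have hq' : q ∈ I ∧ IsIdempotent.{u, v, w} V q := ⟨hqI, hq⟩
    beta_reduce
    rw [dif_pos hp', dif_pos hq']
    exact h _ _ σ τ (by simpa using hpq)
  choose a b σ τ hst hne using hbad
  let d : (Fin m → Fin k) ≃ Fin (Fintype.card (Fin m → Fin k)) := Fintype.equivFin _
  -- Collapsing to two variables this way separates the two sides `σ (c a)` and `τ (c b)` of the
  -- violated equality.
  let χ : (Fin m → Fin k) → Fin k → Fin 2 := fun c l => if l = σ c (c (a c)) then 0 else 1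
  refine hV ⟨_, Fintype.card_pos_iff.2 ⟨fun _ => ⟨0, hk⟩⟩, s.relabel d, ?_,
    fun i j => χ (d.symm i) (σ (d.symm i) (d.symm j (a (d.symm i)))),
    fun i j => χ (d.symm i) (τ (d.symm i) (d.symm j (b (d.symm i)))), fun i => ?_, fun i => ?_⟩
  · rw [isIdempotent_iff]
    intro A _ hA a
    rw [Term.realize_relabel]
    exact hs A hA a
  · have := hne (d.symm i)
    simp only [χ, if_true]
    rw [if_neg (Ne.symm this)]
    decide
  · intro A _ hA x
    simp only [Term.realize_relabel, Function.comp_def, Equiv.symm_apply_apply]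
    generalize d.symm i = c
    have h1 := hsp A hA (a c) fun l => x (χ c (σ c l))
    have h2 := hsp A hA (b c) fun l => x (χ c (τ c l))
    have h3 := hst c A hA fun l => x (χ c l)
    simp only [Term.realize_relabel, Function.comp_def] at h3
    rw [h1, h2, h3]

/-- Compactness by Rado selection: each condition on `φ` involves only two terms. -/
theorem exists_isMinorChoice (hV : ¬IsTaylor.{u, v, w} V) {k : ℕ} (hk : 0 < k) :
    ∃ φ : L.Term (Fin k) → Fin k, IsMinorChoice.{u, v, w} V Set.univ φ := by
  classical
  choose g hg using exists_isMinorChoice_finset hV hk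
  obtain ⟨φ, hφ⟩ := Finset.rado_selection (β := fun _ : L.Term (Fin k) => Fin k) g
  refine ⟨φ, fun p _ q _ hp hq σ τ h => ?_⟩
  obtain ⟨t, hst, ht⟩ := hφ {p, q}
  rw [ht p (by simp), ht q (by simp)]
  exact hg t p (hst (by simp)) q (hst (by simp)) hp hq σ τ h

/-! ## Congruences of the free algebra bounded by partitions of the generators -/

section Bounded

variable {k : ℕ} {φ : L.Term (Fin k) → Fin k}

/-- The elements represented by an idempotent term. -/
def Free.IsIdem (e : Free.{u, v, w} V (Fin k)) : Prop := IsIdempotent.{u, v, w} V e.rep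

/-- The congruence `θ` of the free algebra preserves idempotence, and the variables chosen by `φ`
for related elements lie in the same class of the kernel of `c`. -/
def IsBounded (φ : L.Term (Fin k) → Fin k) (θ : Congruence L (Free.{u, v, w} V (Fin k)))
    {C : Type} (c : Fin k → C) : Prop :=
  ∀ e e', θ.Rel e e' → (e.IsIdem ↔ e'.IsIdem) ∧ (e.IsIdem → c (φ e.rep) = c (φ e'.rep))

theorem IsBounded.mono {θ θ' : Congruence L (Free.{u, v, w} V (Fin k))} {C : Type} {c : Fin k → C}
    (h : IsBounded φ θ' c) (hle : θ ≤ θ') : IsBounded φ θ c := fun e e' he => h e e' (hle e e' he)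

theorem IsBounded.coarsen {θ : Congruence L (Free.{u, v, w} V (Fin k))} {C D : Type}
    {c : Fin k → C} {d : Fin k → D} (h : IsBounded φ θ c) (hcd : ∀ i j, c i = c j → d i = d j) :
    IsBounded φ θ d := fun e e' he =>
  ⟨(h e e' he).1, fun hi => hcd _ _ ((h e e' he).2 hi)⟩

theorem IsBounded.pi {ι : Type} [Nonempty ι] {θ : Congruence L (Free.{u, v, w} V (Fin k))}
    {C : ι → Type} {c : ∀ i, Fin k → C i} (h : ∀ i, IsBounded φ θ (c i)) :
    IsBounded φ θ fun l i => c i l := fun e e' he =>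
  ⟨(h (Classical.arbitrary ι) e e' he).1, fun hi => funext fun i => (h i e e' he).2 hi⟩

theorem IsBounded.inf {θ θ' : Congruence L (Free.{u, v, w} V (Fin k))} {C C' : Type}
    {c : Fin k → C} {c' : Fin k → C'} (h : IsBounded φ θ c) (h' : IsBounded φ θ' c') :
    IsBounded φ (θ ⊓ θ') fun l => (c l, c' l) := fun e e' he =>
  have h1 := h.mono (inf_le_left : θ ⊓ θ' ≤ θ) e e' he
  have h2 := h'.mono (inf_le_right : θ ⊓ θ' ≤ θ') e e' he
  ⟨h1.1, fun hi => Prod.ext (h1.2 hi) (h2.2 hi)⟩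

/-- The bound passes along chains because idempotence is carried to every intermediate element; `φ`
is controlled only at idempotent terms. -/
theorem IsBounded.sSup {S : Set (Congruence L (Free.{u, v, w} V (Fin k)))} {C : Type}
    {c : Fin k → C} (h : ∀ θ ∈ S, IsBounded φ θ c) : IsBounded φ (sSup S) c := by
  intro e e' he
  have hgen := Congruence.eqvGen_of_rel_sSup he
  clear he
  induction hgen with
  | rel a b hab =>
    obtain ⟨θ, hθ, hab⟩ := hab
    exact h θ hθ a b hab
  | refl a => exact ⟨Iff.rfl, fun _ => rfl⟩
  | symm a b _ ih => exact ⟨ih.1.symm, fun hb => (ih.2 (ih.1.2 hb)).symm⟩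
  | trans a b d _ _ ih ih' =>
    exact ⟨ih.1.trans ih'.1, fun ha => (ih.2 ha).trans (ih'.2 (ih.1.1 ha))⟩

theorem IsBounded.iSup {ι : Sort*} {θ : ι → Congruence L (Free.{u, v, w} V (Fin k))} {C : Type}
    {c : Fin k → C} (h : ∀ i, IsBounded φ (θ i) c) : IsBounded φ (⨆ i, θ i) c := by
  refine IsBounded.sSup ?_
  rintro _ ⟨i, rfl⟩
  exact h i

theorem IsBounded.sup {θ θ' : Congruence L (Free.{u, v, w} V (Fin k))} {C : Type} {c : Fin k → C}
    (h : IsBounded φ θ c) (h' : IsBounded φ θ' c) : IsBounded φ (θ ⊔ θ') c := by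
  rw [← sSup_pair]
  refine IsBounded.sSup ?_
  rintro ψ (rfl | rfl)
  exacts [h, h']

/-- The kernel of the endomorphism of the free algebra induced by a map of the generators. -/
noncomputable def mergeCongruence (V : Variety L) (σ : Fin k → Fin k) :
    Congruence L (Free.{u, v, w} V (Fin k)) where
  toSetoid := Setoid.ker fun e => (Free.mk (e.rep.relabel σ) : Free.{u, v, w} V (Fin k))
  map_funMap f x y h := by
    have key : ∀ x : Fin _ → Free.{u, v, w} V (Fin k),
        (Free.mk ((Structure.funMap f x : Free.{u, v, w} V (Fin k)).rep.relabel σ) :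
          Free.{u, v, w} V (Fin k)) =
        Structure.funMap f fun i => (Free.mk ((x i).rep.relabel σ) : Free.{u, v, w} V (Fin k)) := by
      intro x
      have h1 := Free.mk_eq_mk.1 (Free.mk_rep (Structure.funMap f x : Free.{u, v, w} V (Fin k)))
      refine Free.mk_eq_mk.2 fun A _ hA z => ?_
      rw [Term.realize_relabel, h1 A hA]
      simp only [Term.realize_func]
      congr 1
      funext i
      rw [← Term.realize_relabel]
      exact (Free.mk_eq_mk.1 (Free.mk_rep _) A hA z).symm
    rw [Setoid.ker_def, key, key]
    congr 1
    funext i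
    exact h i

theorem mergeCongruence_rel_gen {σ : Fin k → Fin k} {i j : Fin k} (h : σ i = σ j) :
    (mergeCongruence.{u, v, w} V σ).Rel (Free.gen i) (Free.gen j) := by
  have key : ∀ i, (Free.mk ((Free.gen i : Free.{u, v, w} V (Fin k)).rep.relabel σ) :
      Free.{u, v, w} V (Fin k)) = Free.gen (σ i) := by
    intro i
    refine Free.mk_eq_mk.2 fun A _ hA z => ?_
    rw [Term.realize_relabel, Free.mk_eq_mk.1 (Free.mk_rep (Free.gen i)) A hA]
    rfl
  change Free.mk _ = Free.mk _
  rw [key, key, h]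

/-- Related elements have equal `σ`-minors. Identifying all variables transfers idempotence, and
compatibility of `φ` with minors gives the rest. -/
theorem isBounded_mergeCongruence (hφ : IsMinorChoice.{u, v, w} V Set.univ φ) (σ : Fin k → Fin k) :
    IsBounded φ (mergeCongruence.{u, v, w} V σ) σ := by
  have one : ∀ e e' : Free.{u, v, w} V (Fin k),
      (mergeCongruence.{u, v, w} V σ).Rel e e' → e.IsIdem → e'.IsIdem := by
    intro e e' he h
    have he := Free.mk_eq_mk.1 (show Free.mk _ = Free.mk _ from he)
    refine isIdempotent_iff.2 fun A _ hA a => ?_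
    have := he A hA fun _ => a
    simp only [Term.realize_relabel, Function.comp_def] at this
    exact this.symm.trans (isIdempotent_iff.1 h A hA a)
  intro e e' he
  have hi : e.IsIdem ↔ e'.IsIdem := ⟨one e e' he, one e' e (Congruence.rel_symm _ he)⟩
  exact ⟨hi, fun h => hφ _ trivial _ trivial h (hi.1 h) σ σ
    (Free.mk_eq_mk.1 (show Free.mk _ = Free.mk _ from he))⟩

/-- A representative `p` satisfies p ≈ xᵢ, so it equals its minor with all variables replaced by xᵢ;
compatibility with this pair of minors forces the choice. -/
theorem IsMinorChoice.rep_gen (hφ : IsMinorChoice.{u, v, w} V Set.univ φ) (i : Fin k) :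
    (Free.gen i : Free.{u, v, w} V (Fin k)).IsIdem ∧
      φ (Free.gen i : Free.{u, v, w} V (Fin k)).rep = i := by
  have h := Free.mk_eq_mk.1 (Free.mk_rep (Free.gen i : Free.{u, v, w} V (Fin k)))
  have hi : (Free.gen i : Free.{u, v, w} V (Fin k)).IsIdem :=
    isIdempotent_iff.2 fun A _ hA a => h A hA fun _ => a
  refine ⟨hi, ?_⟩
  refine hφ _ trivial _ trivial hi hi id (fun _ => i) fun A _ hA x => ?_
  rw [Term.realize_relabel, Term.realize_relabel, h A hA, h A hA]
  rfl

end Bounded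

/-! ## From the congruence inclusion to a Taylor term -/

/-- `α i` glues x to `z i` and `β i` glues `z i` to y, so (x, y) lies in every product. It remains
to bound the right-hand side by the discrete partition. -/
theorem SatisfiesTaylorInclusion.isTaylor (h : SatisfiesTaylorInclusion.{u, v, w} V) :
    IsTaylor.{u, v, w} V := by
  by_contra hV
  obtain ⟨φ, hφ⟩ := exists_isMinorChoice hV (k := 8) (by norm_num)
  -- the generators are `x = 0`, `y = 1` and `z i = i + 2`
  let z : Fin 6 → Fin 8 := fun i => i.natAdd 2
  let σ : Fin 6 → Fin 8 → Fin 8 := fun i l => if l = z i then 0 else l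
  let τ : Fin 6 → Fin 8 → Fin 8 := fun i l => if l = z i then 1 else l
  let α : Fin 6 → Congruence L (Free.{u, v, w} V (Fin 8)) := fun i => mergeCongruence V (σ i)
  let β : Fin 6 → Congruence L (Free.{u, v, w} V (Fin 8)) := fun i => mergeCongruence V (τ i)
  have hα : ∀ {C : Type} (c : Fin 8 → C) (i : Fin 6), (∀ l m, σ i l = σ i m → c l = c m) →
      IsBounded φ (α i) c := fun c i hc => (isBounded_mergeCongruence hφ (σ i)).coarsen hc
  have hβ : ∀ {C : Type} (c : Fin 8 → C) (i : Fin 6), (∀ l m, τ i l = τ i m → c l = c m) →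
      IsBounded φ (β i) c := fun c i hc => (isBounded_mergeCongruence hφ (τ i)).coarsen hc
  have hpj : ∀ (S S' : Finset (Fin 6)) (c : Fin 8 → Fin 2),
      (∀ i ∈ S, ∀ l m, σ i l = σ i m → c l = c m) →
      (∀ i ∈ S', ∀ l m, τ i l = τ i m → c l = c m) →
      IsBounded φ (partialJoin α β S S') c := fun S S' c h h' =>
    (IsBounded.iSup fun i => .iSup fun hi => hα c i (h i hi)).sup
      (.iSup fun i => .iSup fun hi => hβ c i (h' i hi))
  have hA : IsBounded φ (⨆ i, α i) (![0, 1, 0, 0, 0, 0, 0, 0] : Fin 8 → Fin 2) :=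
    .iSup fun i => hα _ i (by revert i; decide)
  have hB : IsBounded φ (⨆ i, β i) (![0, 1, 1, 1, 1, 1, 1, 1] : Fin 8 → Fin 2) :=
    .iSup fun i => hβ _ i (by revert i; decide)
  -- Each αᵢ ∨ βᵢ is bounded by gluing x, y and `z i`; in the intersection over i only x and y
  -- remain glued.
  have hγ : IsBounded φ (gamma α β) fun l => if l = 1 then 0 else l := by
    have : IsBounded φ (gamma α β) fun l i => if l = 1 ∨ l = z i then 0 else l :=
      IsBounded.pi fun i => IsBounded.mono
        ((hα _ i (by revert i; decide)).sup (hβ _ i (by revert i; decide)))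
        (iInf_le (fun i => α i ⊔ β i) i)
    exact this.coarsen (by decide)
  have hL := hpj {0, 4, 5} {1, 2, 3} ![0, 1, 0, 1, 1, 1, 0, 0] (by decide) (by decide)
  have hR₁ := hpj {1, 3, 5} {0, 2, 4} ![0, 1, 1, 0, 1, 0, 1, 0] (by decide) (by decide)
  have hR₂ := hpj {2, 3, 4} {0, 1, 5} ![0, 1, 1, 1, 0, 0, 0, 1] (by decide) (by decide)
  have h₁ : IsBounded φ (gamma α β ⊔ theta₁ α β) (![0, 0, 1, 2, 0, 2, 1, 0] : Fin 8 → Fin 3) :=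
    (hγ.coarsen (by decide)).sup ((hL.inf hR₁).coarsen (by decide))
  have h₂ : IsBounded φ (gamma α β ⊔ theta₂ α β) (![0, 0, 1, 0, 2, 2, 0, 1] : Fin 8 → Fin 3) :=
    (hγ.coarsen (by decide)).sup ((hL.inf hR₂).coarsen (by decide))
  -- The partitions in `h₁` and `h₂` have only the pair x, y in common, and those in `hA` and `hB`
  -- each separate x from y; so both joinands are bounded by the discrete partition.
  have hrhs : IsBounded φ (taylorRhs α β) (id : Fin 8 → Fin 8) :=
    ((hA.inf (h₁.inf h₂)).coarsen (by decide)).sup ((hB.inf (h₁.inf h₂)).coarsen (by decide))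
  have hrel := h (Free.{u, v, w} V (Fin 8)) Free.mem α β (Free.gen 0) (Free.gen 1) fun i =>
    ⟨Free.gen (z i), mergeCongruence_rel_gen (by revert i; decide),
      mergeCongruence_rel_gen (by revert i; decide)⟩
  have h01 := (hrhs _ _ hrel).2 (hφ.rep_gen 0).1
  rw [(hφ.rep_gen 0).2, (hφ.rep_gen 1).2] at h01
  exact absurd h01 (by decide)

end Variety

end UniversalAlgebra

theorem theorem4p2 {L : FirstOrder.Language.{u, v}} [L.IsAlgebraic]
    (V : UniversalAlgebra.Variety L) :
    List.TFAE
      [UniversalAlgebra.Variety.IsTaylor.{u, v, w} V,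
       UniversalAlgebra.Variety.HasOlsakTerm.{u, v, w} V,
       UniversalAlgebra.Variety.SatisfiesTaylorInclusion.{u, v, w} V] := by
  tfae_have 1 → 2 := UniversalAlgebra.Variety.IsTaylor.hasOlsakTerm
  tfae_have 2 → 3 := UniversalAlgebra.Variety.HasOlsakTerm.satisfiesTaylorInclusion
  tfae_have 3 → 1 := UniversalAlgebra.Variety.SatisfiesTaylorInclusion.isTaylor
  tfae_finish
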